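/- **The graphs.** Let $T_3$ be the infinite tree with a root $r$ of degree $3$ in which all other vertices have degree $4$. Let $H_2$ be the plane graph obtained from $T_3$ by putting, for every $n\ge 1$, a cycle of length $3^n$ on the vertices at distance $n$ from $r$ (in the cyclic order of a planar embedding of $T_3$). The height $h(t)$ of a vertex $t$ of $H_2$ is its distance from $r$. Let $W$ be the graph with vertices $r_i^k$ ($i\in\{0,1,2,\dots\}$, $k\in\mathbb Z$), edges $r_i^k r_i^{k+1}$ and edges $r_i^k r_{i+1}^{2k}$; put $h(r_i^k)=i$. Let $H_3$ be the graph whose vertices are the pairs $(t,w)\in V(H_2)\times V(W)$ with $h(t)=h(w)$, where distinct vertices $(t,w)$, $(t',w')$ are adjacent if and only if either $tt'\in E(H_2)$ and $ww'\in E(W)$, or $tt'\in E(H_2)$ and $w=w'$, or $t=t'$ and $ww'\in E(W)$. **The hyperbolic souvlaki.** For $n\ge 1$ let $B_n$ be the set of the vertices $r_i^k$ of $W$ with $i\le 2^n$ and $0\le k/2^i\le 3\cdot 2^n$ (those of height at most $2^n$ that lie in or above the path $r_0^0r_0^1\cdots r_0^{3\cdot 2^n}$), and let the meatball $M_n$ be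 the finite subgraph of $H_3$ induced by the vertices $(t,w)$ with $w\in B_n$. Write $r(x)=(r,r_0^x)$ for $0\le x\le 3\cdot 2^n$, $L_n=\{r(x): 0\le x<2^n\}$, $m_n=r(2^n)$ and $R_n=\{r(x): 2^n<x\le 3\cdot 2^n\}$. The graph $\Psi$ is obtained from a ray $S=s_0s_1s_2\cdots$ and disjoint copies of $M_1,M_2,\dots$ by identifying, in the order of $S$, the vertices $r(0),r(1),\dots,r(3\cdot 2^n)$ of each $M_n$ with consecutive vertices of $S$, so that $r(0)\in M_1$ is identified with the root $o:=s_0$ and, for every $n\ge 2$, $L_n$ is identified with $R_{n-1}$ (parallel edges being merged). **Theorem.** The graph $\Psi$ is transient: for every vertex $v$ of $\Psi$, the probability that simple random walk on $\Psi$ started at $v$ ever returns to $v$ is less than $1$. Moreover, $\Psi$ carries a unit flow from $o$ to infinity with finite Dirichlet energy, that is, there is a function $f$ on the directed edges of $\Psi$ with $f(x,y)=-f(y,x)$, with net outflow $\sum_{y\sim x}f(x,y)$ equal to $1$ at $x=o$ and to $0$ at every other vertex $x$, and with $\sum_{xy\in E(\Psi)}f(x,y)^2<\infty$. -/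

import Mathlib

open MeasureTheory ProbabilityTheory

namespace Souvlaki

/-! ### Simple random walk, transience, flows -/

section Walk

variable {V : Type*}

open Classical in
/-- One step of simple random walk: from `v` the walk moves to a uniformly chosen neighbour
(and, by convention, it rests at `v` if `v` is an isolated vertex). -/
noncomputable def stepPMF (G : SimpleGraph V) [G.LocallyFinite] (v : V) : PMF V :=
  if h : (G.neighborFinset v).Nonempty then PMF.uniformOfFinset (G.neighborFinset v) h
  else PMF.pure v

/-- The transition kernel at time `n` of simple random walk, as a kernel on the history up to
time `n`; it depends on the present position only. -/
noncomputable def stepKernel [MeasurableSpace V] [DiscreteMeasurableSpace V]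
    (G : SimpleGraph V) [G.LocallyFinite] (n : ℕ) :
    Kernel ((i : Finset.Iic n) → (fun _ : ℕ => V) i) V where
  toFun x := (stepPMF G (x ⟨n, Finset.mem_Iic.2 le_rfl⟩)).toMeasure
  measurable' := (measurable_from_top (f := fun v => (stepPMF G v).toMeasure)).comp
    ((measurable_pi_apply (⟨n, Finset.mem_Iic.2 le_rfl⟩ : Finset.Iic n)).mono le_rfl
      (fun _ _ => MeasurableSet.of_discrete))

instance [MeasurableSpace V] [DiscreteMeasurableSpace V]
    (G : SimpleGraph V) [G.LocallyFinite] (n : ℕ) : IsMarkovKernel (stepKernel G n) :=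
  ⟨fun _ => PMF.toMeasure.isProbabilityMeasure _⟩

/-- The law, on the space `ℕ → V` of trajectories, of simple random walk on `G` started
at `v`. -/
noncomputable def walkLaw [MeasurableSpace V] [DiscreteMeasurableSpace V]
    (G : SimpleGraph V) [G.LocallyFinite] (v : V) : Measure (ℕ → V) :=
  Kernel.traj (X := fun _ => V) (stepKernel G) 0 (fun _ => v)

/-- `G` is transient: from every vertex, the probability that simple random walk ever returns to
its starting vertex is less than `1`. -/
def IsTransient (G : SimpleGraph V) [G.LocallyFinite] : Prop :=
  letI : MeasurableSpace V := ⊤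
  ∀ v : V, walkLaw G v {ω | ∃ n : ℕ, 1 ≤ n ∧ ω n = v} < 1

open Classical in
/-- `f` is a unit flow on `G` from the vertex `o` to infinity: an antisymmetric function on
directed edges whose net outflow is `1` at `o` and `0` at all other vertices. -/
structure IsUnitFlowToInfinity (G : SimpleGraph V) [G.LocallyFinite] (o : V)
    (f : V → V → ℝ) : Prop where
  antisymm : ∀ x y, f y x = - f x y
  support : ∀ x y, ¬ G.Adj x y → f x y = 0
  outflow : ∀ x, ∑ y ∈ G.neighborFinset x, f x y = if x = o then 1 else 0

/-- `f` has finite Dirichlet energy. (Each edge is counted once in each direction.) -/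
def HasFiniteEnergy (f : V → V → ℝ) : Prop :=
  Summable fun e : V × V => f e.1 e.2 ^ 2

end Walk

/-! ### The graphs `T₃`, `H₂`, `W`, `H₃` -/

/-- The vertices of `T₃` and of `H₂`: the pair `⟨n, i⟩` is the `i`-th vertex, in the cyclic order
of its level, at distance `n` from the root. -/
abbrev H2Vert : Type := Σ n : ℕ, Fin (3 ^ n)

/-- The tree `T₃`: the vertex `i` of level `n` has the three outer neighbours
`3 * i`, `3 * i + 1`, `3 * i + 2` in level `n + 1`. -/
def T3 : SimpleGraph H2Vert :=
  SimpleGraph.fromRel fun s t => t.1 = s.1 + 1 ∧ (t.2 : ℕ) / 3 = (s.2 : ℕ)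

/-- The cycles of length `3 ^ n` on the levels `n ≥ 1` of `T₃`
(level `0` consists of the root alone and receives no edge). -/
def levelCycles : SimpleGraph H2Vert :=
  SimpleGraph.fromRel fun s t => t.1 = s.1 ∧ (t.2 : ℕ) = ((s.2 : ℕ) + 1) % 3 ^ s.1

/-- The planar graph `H₂`. -/
def H2 : SimpleGraph H2Vert := T3 ⊔ levelCycles

/-- The vertices of `W`: the pair `(i, k)` is the vertex `r_i^k` of the double ray `D_i`. -/
abbrev WVert : Type := ℕ × ℤ

/-- The graph `W`: the double rays `D_i`, with the additional edges `r_i^k r_{i+1}^{2k}`. -/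
def W : SimpleGraph WVert :=
  SimpleGraph.fromRel fun v w =>
    (w.1 = v.1 ∧ w.2 = v.2 + 1) ∨ (w.1 = v.1 + 1 ∧ w.2 = 2 * v.2)

/-- The height of a vertex of `H₂`; it is the distance from the root, see `dist_root`. -/
def H2Vert.height (t : H2Vert) : ℕ := t.1

/-- The height of a vertex of `W`: the index of the double ray that contains it. -/
def WVert.height (w : WVert) : ℕ := w.1

/-- The vertices of `H₃`: the pairs `(t, w)` with `h(t) = h(w)`. -/
abbrev H3Vert : Type := {p : H2Vert × WVert // H2Vert.height p.1 = WVert.height p.2}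

/-- The graph `H₃`. -/
def H3 : SimpleGraph H3Vert where
  Adj p q :=
    (H2.Adj p.1.1 q.1.1 ∧ W.Adj p.1.2 q.1.2) ∨
    (H2.Adj p.1.1 q.1.1 ∧ p.1.2 = q.1.2) ∨
    (p.1.1 = q.1.1 ∧ W.Adj p.1.2 q.1.2)
  symm.symm p q h := by
    rcases h with ⟨h, h'⟩ | ⟨h, h'⟩ | ⟨h, h'⟩
    · exact Or.inl ⟨h.symm, h'.symm⟩
    · exact Or.inr (Or.inl ⟨h.symm, h'.symm⟩)
    · exact Or.inr (Or.inr ⟨h.symm, h'.symm⟩)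
  loopless.irrefl p h := by
    rcases h with ⟨h, _⟩ | ⟨h, _⟩ | ⟨_, h⟩
    · exact h.ne rfl
    · exact h.ne rfl
    · exact h.ne rfl

/-! ### The meatballs and the souvlaki -/

/-- The box `B_n`: the vertices `r_i^k` of `W` that lie in or above the path
`P_n = r_0^0 r_0^1 ⋯ r_0^{3·2^n}` (`r_i^k` being drawn at horizontal position `k / 2 ^ i`) and whose
height is at most `2 ^ n`, the number of vertices of `L_n`. -/
def box (n : ℕ) : Set WVert :=
  {w | WVert.height w ≤ 2 ^ n ∧ 0 ≤ w.2 ∧ w.2 ≤ 2 ^ WVert.height w * (3 * 2 ^ n)}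

/-- The vertex set of the meatball `M_n`. -/
def ballSet (n : ℕ) : Set H3Vert := {p | p.1.2 ∈ box n}

/-- The meatball `M_n`: the subgraph of `H₃` spanned by the `(t, w)` with `w ∈ B_n`. -/
def ball (n : ℕ) : SimpleGraph (ballSet n) := H3.induce (ballSet n)

/-- The height of a vertex of `M_n`. The vertices of height `0` form `S_n`; the
vertex of height `0` over `r_0^x` is `r(x)`. -/
def ballHeight {n : ℕ} (p : ballSet n) : ℕ := WVert.height p.1.1.2

/-- The position on the skewer `S = s_0 s_1 ⋯` at which `M_n` begins, so that `r(x) ∈ S_n` is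
glued to the vertex `s_{start n + x}`. As `M_1` begins at `s_0`, and the first vertex of `R_n` is
glued to the first vertex of `L_{n+1}`, this is `∑_{k < n} |L_k ∪ {m_k}|`. -/
def start (n : ℕ) : ℕ := ∑ k ∈ Finset.Ico 1 n, (2 ^ k + 1)

/-- The vertices of `Ψ`: those of the skewer, and, for every `n ≥ 1`, those vertices of `M_n` that
are not in `S_n`. -/
abbrev PsiVert : Type :=
  ℕ ⊕ {v : Σ n : ℕ, ballSet n // 1 ≤ v.1 ∧ 0 < ballHeight v.2}

open Classical in
/-- The gluing map from `M_n` to `Ψ`, for `n ≥ 1`. -/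
noncomputable def glue (n : ℕ) (hn : 1 ≤ n) (p : ballSet n) : PsiVert :=
  if h : 0 < ballHeight p then Sum.inr ⟨⟨n, p⟩, hn, h⟩
  else Sum.inl (start n + p.1.1.2.2.toNat)

/-- The hyperbolic souvlaki `Ψ`: the union of the ray `S` and of the images of the meatballs
`M_n`, `n ≥ 1`, under the gluing maps. -/
noncomputable def Psi : SimpleGraph PsiVert :=
  (SimpleGraph.hasse ℕ).map Sum.inl ⊔ ⨆ (n : ℕ) (hn : 1 ≤ n), (ball n).map (glue n hn)

/-- The root `o` of `Ψ`, the first vertex of the skewer. -/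
def root : PsiVert := Sum.inl 0

/-! ### Facts needed for the definitions -/

/-- The height of a vertex of `H₂` is its distance from the root. -/
theorem dist_root (t : H2Vert) : H2.dist ⟨0, 0⟩ t = H2Vert.height t := by
  have up : ∀ n (i : Fin (3 ^ n)), ∃ p : H2.Walk ⟨0, 0⟩ ⟨n, i⟩, p.length = n := by
    intro n
    induction n with
    | zero => exact fun i => ⟨SimpleGraph.Walk.nil.copy rfl (by
        congr 1; exact Subsingleton.elim (α := Fin 1) _ _), by simp⟩
    | succ n ih =>
      intro i
      have hi : (i : ℕ) / 3 < 3 ^ n := by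
        have h1 := i.2
        have h2 : 3 ^ (n + 1) = 3 ^ n * 3 := pow_succ 3 n
        omega
      obtain ⟨p, hp⟩ := ih ⟨(i : ℕ) / 3, hi⟩
      have hadj : H2.Adj ⟨n, ⟨(i : ℕ) / 3, hi⟩⟩ ⟨n + 1, i⟩ := Or.inl (by simp [T3])
      exact ⟨p.concat hadj, by simp [hp]⟩
  have lip : ∀ (s u : H2Vert) (p : H2.Walk s u), u.1 ≤ s.1 + p.length := by
    intro s u p
    induction p with
    | nil => simp
    | cons h p ih =>
      rw [SimpleGraph.Walk.length_cons]
      have h' := h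
      rw [H2, SimpleGraph.sup_adj, T3, levelCycles, SimpleGraph.fromRel_adj,
        SimpleGraph.fromRel_adj] at h'
      omega
  obtain ⟨n, i⟩ := t
  obtain ⟨p, hp⟩ := up n i
  apply le_antisymm
  · exact (SimpleGraph.dist_le p).trans hp.le
  · obtain ⟨q, hq⟩ := p.reachable.exists_walk_length_eq_dist
    have h1 : n ≤ 0 + q.length := lip _ _ q
    rw [hq, zero_add] at h1
    exact h1

/-- The meatballs are finite. -/
theorem finite_ballSet (n : ℕ) : Finite (ballSet n) := by
  let N : ℕ := 2 ^ n
  let K : ℤ := 2 ^ N * (3 * 2 ^ n)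
  have key : (ballSet n) ⊆ (fun p : H3Vert => p.1) ⁻¹'
      ((Set.range fun x : (Σ i : Fin (N + 1), Fin (3 ^ (i : ℕ))) => (⟨x.1, x.2⟩ : H2Vert)) ×ˢ
        (Set.Iic N ×ˢ Set.Icc 0 K)) := by
    rintro ⟨⟨⟨i, t⟩, ⟨j, k⟩⟩, h⟩ ⟨h1, h2, h3⟩
    simp only [H2Vert.height, WVert.height] at h h1 h2 h3
    subst h
    refine ⟨⟨⟨⟨i, Nat.lt_succ_of_le h1⟩, t⟩, rfl⟩, h1, h2, h3.trans ?_⟩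
    exact mul_le_mul_of_nonneg_right (pow_le_pow_right₀ (by norm_num) h1) (by positivity)
  exact (((Set.finite_range _).prod ((Set.finite_Iic N).prod (Set.finite_Icc 0 K))).preimage
    Subtype.val_injective.injOn).subset key

/-- Every vertex of `Ψ` has finitely many neighbours. -/
theorem finite_neighborSet (x : PsiVert) : (Psi.neighborSet x).Finite := by
  have hstart : ∀ n, n ≤ start n + 1 := by
    intro n
    have := Finset.card_nsmul_le_sum (Finset.Ico 1 n) (fun k => 2 ^ k + 1) 1 (fun k _ => by simp)
    simp only [Nat.card_Ico, smul_eq_mul, mul_one] at this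
    simp only [start]
    omega
  let b : ℕ := Sum.elim (fun s => s + 1) (fun v => v.1.1) x
  have hb : ∀ n hn p, glue n hn p = x → n ≤ b := by
    rintro n hn p rfl
    by_cases h : 0 < ballHeight p
    · simp [b, glue, h]
    · have := hstart n
      simp only [b, glue, h, dite_false, Sum.elim_inl]
      omega
  let A : Set PsiVert := Sum.elim (fun s => Sum.inl '' Set.Iic (s + 1)) (fun _ => ∅) x
  have hA : A.Finite := by
    rcases x with s | v
    · exact (Set.finite_Iic (s + 1)).image _
    · exact Set.finite_empty
  have hB : (⋃ n ∈ Set.Iic b, ⋃ hn : 1 ≤ n, Set.range (glue n hn)).Finite := by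
    refine (Set.finite_Iic b).biUnion fun n _ => Set.finite_iUnion fun hn => ?_
    have := finite_ballSet n
    exact Set.finite_range _
  refine (hA.union hB).subset ?_
  intro y hy
  rw [SimpleGraph.mem_neighborSet, Psi, SimpleGraph.sup_adj] at hy
  rcases hy with ⟨_, s, t, hst, rfl, rfl⟩ | hy
  · left
    refine ⟨t, ?_, rfl⟩
    rw [SimpleGraph.hasse_adj, Nat.covBy_iff_add_one_eq, Nat.covBy_iff_add_one_eq] at hst
    simp only [Set.mem_Iic]
    omega
  · right
    simp only [SimpleGraph.iSup_adj] at hy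
    obtain ⟨n, hn, _, p, q, _, hp, rfl⟩ := hy
    simp only [Set.mem_iUnion]
    exact ⟨n, hb n hn p hp, hn, q, rfl⟩

noncomputable instance : Psi.LocallyFinite := fun x => (finite_neighborSet x).fintype

end Souvlaki

/-! A finite-energy unit flow forces transience (T. Lyons' criterion), and such a flow is written
down explicitly.

Criterion. Let `u` be the probability of hitting `v` within `n` steps. It is finitely supported,
equals 1 at `v`, and is subharmonic off `v` because it increases with `n`. Pair the flow with the
gradient of `u`, apply Cauchy–Schwarz and sum by parts: only the term at `v` survives with a
positive sign, so 2 ≤ E·deg(v)·(1 − p), where E is the energy over directed edges and p the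
probability of returning within `n + 1` steps (`sq_le_energy_mul`, `exists_avg_hitProb_le`). Thus p
stays away from 1 uniformly in `n`. First-step analysis transfers this to the trajectory measure
(`traj_visit_le`).

Flow. The unit is relayed through the meatballs: M_n receives it on L_n and returns it uniformly on
R_n = L_{n+1}. These contributions telescope, so on the skewer only the source at the root remains
(`sum_supply`). Inside M_n the supply of r(x) climbs the column of the r_i^{2^i x}, splitting in
three at each level. At height N = 2^n it runs along the 3^N copies of the top path, each carrying
the cumulative supply divided by 3^N. No edge of the skewer is used.

Energy. Level i of the climb has O(2^n 3^i) edges carrying O(2^{-n} 3^{-i}) each, which sums to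
O(2^{-n}) for M_n. The top has O(3^N · N 2^N) edges carrying at most 3^{-N}, a total of O(N
(2/3)^N): the branching 3 of the tree beats the stretching 2 of W. Both bounds are summable over n
(`summable_descent_sq`, `summable_drift_sq`). -/

namespace Souvlaki

/-! ### Finite-energy flows imply transience -/

section FlowImpliesTransience

variable {V : Type*} (G : SimpleGraph V) [G.LocallyFinite]

/-- The average of `u` over the neighbours of `x`. -/
noncomputable def avg (u : V → ℝ) (x : V) : ℝ :=
  (∑ y ∈ G.neighborFinset x, u y) / G.degree x

open Classical in
/-- The probability that simple random walk started at `x` visits `v` within `n` steps. -/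
noncomputable def hitProb (v : V) : ℕ → V → ℝ
  | 0 => fun x => if x = v then 1 else 0
  | n + 1 => fun x => if x = v then 1 else avg G (hitProb v n) x

lemma avg_mono {u u' : V → ℝ} (h : ∀ x, u x ≤ u' x) (x : V) : avg G u x ≤ avg G u' x := by
  unfold avg
  gcongr
  exact h _

lemma avg_nonneg {u : V → ℝ} (h : ∀ x, 0 ≤ u x) (x : V) : 0 ≤ avg G u x :=
  div_nonneg (Finset.sum_nonneg fun _ _ => h _) (Nat.cast_nonneg _)

lemma degree_mul_avg (u : V → ℝ) (x : V) :
    G.degree x * avg G u x = ∑ y ∈ G.neighborFinset x, u y := by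
  unfold avg
  rcases Nat.eq_zero_or_pos (G.degree x) with h | h
  · have : G.neighborFinset x = ∅ := by
      rw [← Finset.card_eq_zero, G.card_neighborFinset_eq_degree, h]
    simp [h, this]
  · have : (G.degree x : ℝ) ≠ 0 := by positivity
    field_simp

@[simp] lemma hitProb_self (v : V) (n : ℕ) : hitProb G v n v = 1 := by
  cases n <;> simp [hitProb]

lemma hitProb_succ_of_ne {v x : V} (h : x ≠ v) (n : ℕ) :
    hitProb G v (n + 1) x = avg G (hitProb G v n) x := by
  simp [hitProb, h]

lemma hitProb_nonneg (v : V) (n : ℕ) (x : V) : 0 ≤ hitProb G v n x := by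
  induction n generalizing x with
  | zero => simp only [hitProb]; split_ifs <;> norm_num
  | succ n ih =>
    simp only [hitProb]
    split_ifs
    · norm_num
    · exact avg_nonneg G ih x

lemma hitProb_le_succ (v : V) (n : ℕ) (x : V) : hitProb G v n x ≤ hitProb G v (n + 1) x := by
  induction n generalizing x with
  | zero =>
    by_cases h : x = v
    · subst h; simp
    · simpa [hitProb, h] using avg_nonneg G (hitProb_nonneg G v 0) x
  | succ n ih =>
    by_cases h : x = v
    · subst h; simp
    · rw [hitProb_succ_of_ne G h, hitProb_succ_of_ne G h]
      exact avg_mono G ih x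

lemma finite_support_hitProb (v : V) (n : ℕ) : (Function.support (hitProb G v n)).Finite := by
  classical
  induction n with
  | zero =>
    refine (Set.finite_singleton v).subset fun x hx => ?_
    by_contra h
    exact hx (by simpa [hitProb] using h)
  | succ n ih =>
    refine ((Set.finite_singleton v).union
      (ih.biUnion fun y _ => (G.neighborFinset y).finite_toSet)).subset fun x hx => ?_
    by_contra h
    simp only [Set.mem_union, Set.mem_singleton_iff, Set.mem_iUnion, not_or, not_exists] at h
    refine hx ?_
    rw [hitProb_succ_of_ne G h.1, avg, Finset.sum_eq_zero, zero_div]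
    intro y hy
    by_contra h'
    refine h.2 y h' ?_
    simpa [G.adj_comm] using hy

/-- Cauchy–Schwarz for a flow from `v` and a finitely supported potential. -/
lemma sq_le_energy_mul {v : V} {f : V → V → ℝ} (hf : IsUnitFlowToInfinity G v f)
    (hE : HasFiniteEnergy f) {u : V → ℝ} (hu : (Function.support u).Finite) :
    2 * u v ^ 2 ≤ (∑' e : V × V, f e.1 e.2 ^ 2) *
      ∑ x ∈ hu.toFinset, u x * (G.degree x * u x - ∑ y ∈ G.neighborFinset x, u y) := by
  classical
  set S := hu.toFinset with hS
  -- `T` contains every edge meeting the support of `u`, so all sums below are finite.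
  set T := S ∪ S.biUnion (fun x => G.neighborFinset x) with hT
  have hu0 : ∀ x, x ∉ S → u x = 0 := fun x hx => by simpa [hS] using hx
  have hST : S ⊆ T := Finset.subset_union_left
  have hNT : ∀ x ∈ S, G.neighborFinset x ⊆ T := fun x hx =>
    (Finset.subset_biUnion_of_mem (fun x => G.neighborFinset x) hx).trans Finset.subset_union_right
  -- sums over `T × T` of functions supported on edges and weighted by `u`
  have key : ∀ g : V → V → ℝ, (∀ x y, ¬ G.Adj x y → g x y = 0) →
      ∑ x ∈ T, ∑ y ∈ T, u x * g x y = ∑ x ∈ S, u x * ∑ y ∈ G.neighborFinset x, g x y := by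
    intro g hg
    rw [← Finset.sum_subset hST]
    · refine Finset.sum_congr rfl fun x hx => ?_
      rw [Finset.mul_sum, ← Finset.sum_subset (hNT x hx)]
      intro y _ hy
      rw [hg x y (by simpa using hy), mul_zero]
    · intro x _ hx
      simp [hu0 x hx]
  let a : V → V → ℝ := fun x y => if G.Adj x y then 1 else 0
  have ha : ∀ x y, ¬ G.Adj x y → a x y = 0 := fun x y h => by simp [a, h]
  have hasymm : ∀ x y, a y x = a x y := fun x y => by simp [a, G.adj_comm]
  have hflow : ∑ x ∈ T, ∑ y ∈ T, u x * f x y = u v := by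
    rw [key f hf.support]
    have : ∀ x ∈ S, u x * ∑ y ∈ G.neighborFinset x, f x y = if x = v then u v else 0 := by
      intro x _
      rw [hf.outflow x]
      split_ifs with h <;> simp [h]
    rw [Finset.sum_congr rfl this, Finset.sum_ite_eq']
    split_ifs with h
    · rfl
    · exact (hu0 v h).symm
  have hflow' : ∑ x ∈ T, ∑ y ∈ T, u y * f x y = - u v := by
    rw [Finset.sum_comm, ← hflow, ← Finset.sum_neg_distrib]
    refine Finset.sum_congr rfl fun x _ => ?_
    rw [← Finset.sum_neg_distrib]
    exact Finset.sum_congr rfl fun y _ => by rw [hf.antisymm x y]; ring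
  -- Summation by parts; the factor 2 arises because each edge is counted in both directions.
  have hdiff : ∑ p ∈ T ×ˢ T, (a p.1 p.2 * (u p.1 - u p.2)) * f p.1 p.2 = 2 * u v := by
    rw [Finset.sum_product]
    have : ∀ x y, (a x y * (u x - u y)) * f x y = u x * f x y - u y * f x y := by
      intro x y
      by_cases h : G.Adj x y
      · simp [a, h]; ring
      · simp [a, h, hf.support x y h]
    simp only [this, Finset.sum_sub_distrib, hflow, hflow']
    ring
  have hdir : ∑ p ∈ T ×ˢ T, (a p.1 p.2 * (u p.1 - u p.2)) ^ 2 =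
      2 * ∑ x ∈ S, u x * (G.degree x * u x - ∑ y ∈ G.neighborFinset x, u y) := by
    rw [Finset.sum_product]
    have h1 : ∀ x y, (a x y * (u x - u y)) ^ 2 =
        u x * (a x y * (u x - u y)) + u y * (a y x * (u y - u x)) := by
      intro x y
      rw [hasymm x y]
      by_cases h : G.Adj x y
      · simp [a, h]; ring
      · simp [a, h]
    have h2 := key (fun x y => a x y * (u x - u y)) (fun x y h => by simp [ha x y h])
    have h3 : ∑ x ∈ T, ∑ y ∈ T, u y * (a y x * (u y - u x)) =
        ∑ x ∈ T, ∑ y ∈ T, u x * (a x y * (u x - u y)) := Finset.sum_comm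
    simp only [h1, Finset.sum_add_distrib, h3, h2, ← two_mul]
    congr 1
    refine Finset.sum_congr rfl fun x _ => ?_
    congr 1
    have : ∀ y ∈ G.neighborFinset x, a x y * (u x - u y) = u x - u y := by
      intro y hy
      simp only [SimpleGraph.mem_neighborFinset] at hy
      simp [a, hy]
    rw [Finset.sum_congr rfl this, Finset.sum_sub_distrib, Finset.sum_const,
      G.card_neighborFinset_eq_degree, nsmul_eq_mul]
  have hen : ∑ p ∈ T ×ˢ T, f p.1 p.2 ^ 2 ≤ ∑' e : V × V, f e.1 e.2 ^ 2 :=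
    hE.sum_le_tsum _ fun _ _ => sq_nonneg _
  have cs := Finset.sum_mul_sq_le_sq_mul_sq (T ×ˢ T) (fun p => a p.1 p.2 * (u p.1 - u p.2))
    (fun p => f p.1 p.2)
  rw [hdiff, hdir] at cs
  have hD : 0 ≤ 2 * ∑ x ∈ S, u x * (G.degree x * u x - ∑ y ∈ G.neighborFinset x, u y) := by
    rw [← hdir]; positivity
  nlinarith [mul_le_mul_of_nonneg_left hen hD]

/-- If `v` carries a unit flow to infinity of finite energy, then the probability of returning to
`v` within `n` steps is bounded away from `1`. -/
lemma exists_avg_hitProb_le {v : V} {f : V → V → ℝ} (hf : IsUnitFlowToInfinity G v f)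
    (hE : HasFiniteEnergy f) : ∃ c < 1, ∀ n, avg G (hitProb G v n) v ≤ c := by
  classical
  set E := ∑' e : V × V, f e.1 e.2 ^ 2
  have hE0 : 0 ≤ E := tsum_nonneg fun _ => sq_nonneg _
  have main : ∀ n, 2 ≤ E * (G.degree v * (1 - avg G (hitProb G v n) v)) := by
    intro n
    have h := sq_le_energy_mul G hf hE (finite_support_hitProb G v n)
    rw [hitProb_self, one_pow, mul_one] at h
    refine h.trans (mul_le_mul_of_nonneg_left ?_ hE0)
    have hv : v ∈ (finite_support_hitProb G v n).toFinset := by simp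
    rw [← Finset.add_sum_erase _ _ hv, hitProb_self, ← degree_mul_avg]
    -- Off `v` the average of `hitProb G v n` is `hitProb G v (n + 1)`, which is at least `hitProb G
    -- v n`.
    have : ∑ x ∈ (finite_support_hitProb G v n).toFinset.erase v, hitProb G v n x *
        (G.degree x * hitProb G v n x - ∑ y ∈ G.neighborFinset x, hitProb G v n y) ≤ 0 := by
      refine Finset.sum_nonpos fun x hx => ?_
      have hx' : x ≠ v := Finset.ne_of_mem_erase hx
      rw [← degree_mul_avg, ← hitProb_succ_of_ne G hx', ← mul_sub]
      refine mul_nonpos_of_nonneg_of_nonpos (hitProb_nonneg G v n x)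
        (mul_nonpos_of_nonneg_of_nonpos (Nat.cast_nonneg _) ?_)
      exact sub_nonpos.2 (hitProb_le_succ G v n x)
    linarith
  have hpos : 0 < E * G.degree v := by
    refine lt_of_le_of_ne (by positivity) fun h => ?_
    have := main 0
    rw [← mul_assoc, ← h, zero_mul] at this
    norm_num at this
  refine ⟨1 - 2 / (E * G.degree v), by linarith [div_pos two_pos hpos], fun n => ?_⟩
  have h2 : 2 / (E * G.degree v) ≤ 1 - avg G (hitProb G v n) v := by
    rw [div_le_iff₀ hpos]
    linarith [main n]
  linarith

/-! ### Return probabilities under the trajectory measure -/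

section Law

variable [MeasurableSpace V] [DiscreteMeasurableSpace V]

lemma lintegral_stepPMF [Countable V] {x : V} (hx : (G.neighborFinset x).Nonempty) {u : V → ℝ}
    (hu : ∀ y, 0 ≤ u y) :
    ∫⁻ y, ENNReal.ofReal (u y) ∂(stepPMF G x).toMeasure = ENNReal.ofReal (avg G u x) := by
  classical
  rw [lintegral_countable']
  have hd : 0 < G.degree x := by
    rw [← G.card_neighborFinset_eq_degree]; exact Finset.card_pos.2 hx
  have h1 : ∀ y, ENNReal.ofReal (u y) * (stepPMF G x).toMeasure {y} =
      if y ∈ G.neighborFinset x then ENNReal.ofReal (u y / G.degree x) else 0 := by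
    intro y
    rw [PMF.toMeasure_apply_singleton _ _ (MeasurableSet.of_discrete), stepPMF, dif_pos hx,
      PMF.uniformOfFinset_apply]
    split_ifs with h
    · rw [ENNReal.ofReal_div_of_pos (by exact_mod_cast hd), G.card_neighborFinset_eq_degree,
        ENNReal.ofReal_natCast, div_eq_mul_inv]
    · rw [mul_zero]
  simp only [h1]
  rw [tsum_eq_sum (s := G.neighborFinset x) (fun y hy => if_neg hy),
    Finset.sum_congr rfl fun y hy => if_pos hy,
    ← ENNReal.ofReal_sum_of_nonneg fun y _ => div_nonneg (hu y) (Nat.cast_nonneg _), avg,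
    Finset.sum_div]

lemma measurableSet_visit (v : V) (a m : ℕ) :
    MeasurableSet {ω : ℕ → V | ∃ k, a < k ∧ k ≤ a + m ∧ ω k = v} := by
  have : {ω : ℕ → V | ∃ k, a < k ∧ k ≤ a + m ∧ ω k = v} =
      ⋃ k ∈ Set.Ioc a (a + m), (fun ω : ℕ → V => ω k) ⁻¹' {v} := by
    ext ω; simp [and_assoc]
  rw [this]
  exact MeasurableSet.biUnion (Set.to_countable _) fun k _ =>
    measurable_pi_apply k (MeasurableSet.of_discrete)

/-- A trajectory continuing the history `x` almost surely agrees with it up to time `a`. -/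
lemma traj_ne_eq_zero {a : ℕ} {v : V} (x : (i : Finset.Iic a) → (fun _ : ℕ => V) i)
    (hx : x ⟨a, Finset.mem_Iic.2 le_rfl⟩ ≠ v) :
    Kernel.traj (X := fun _ => V) (stepKernel G) a x {ω | ω a = v} = 0 := by
  have h := Kernel.traj_map_frestrictLe_apply (X := fun _ => V) (κ := stepKernel G) a a x
  rw [Kernel.partialTraj_self, Kernel.id_apply] at h
  have hm : MeasurableSet {y : (i : Finset.Iic a) → (fun _ : ℕ => V) i |
      y ⟨a, Finset.mem_Iic.2 le_rfl⟩ = v} :=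
    (measurable_pi_apply (X := fun _ : Finset.Iic a => V) ⟨a, Finset.mem_Iic.2 le_rfl⟩)
      (MeasurableSet.of_discrete (s := {v}))
  have h' := congrArg (fun μ => μ {y | y ⟨a, Finset.mem_Iic.2 le_rfl⟩ = v}) h
  rw [Measure.map_apply (by fun_prop) hm, Measure.dirac_apply' _ hm] at h'
  rw [Set.indicator_of_notMem (by exact hx)] at h'
  exact h'

/-- First-step analysis. The starting time `a` is arbitrary because conditioning on one step moves
it to `a + 1`; an upper bound suffices for transience. -/
lemma traj_visit_le [Countable V] (hG : ∀ x, (G.neighborFinset x).Nonempty) (v : V) (m a : ℕ)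
    (x : (i : Finset.Iic a) → (fun _ : ℕ => V) i) :
    Kernel.traj (X := fun _ => V) (stepKernel G) a x
        {ω | ∃ k, a < k ∧ k ≤ a + (m + 1) ∧ ω k = v} ≤
      ENNReal.ofReal (avg G (hitProb G v m) (x ⟨a, Finset.mem_Iic.2 le_rfl⟩)) := by
  -- The conditioning on the position at time `a + 1`, shared by both cases of the induction.
  have step : ∀ (m a : ℕ) (x : (i : Finset.Iic a) → (fun _ : ℕ => V) i),
      (∀ y : (i : Finset.Iic (a + 1)) → (fun _ : ℕ => V) i,
        Kernel.traj (X := fun _ => V) (stepKernel G) (a + 1) y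
          {ω | ∃ k, a < k ∧ k ≤ a + (m + 1) ∧ ω k = v} ≤
        ENNReal.ofReal (hitProb G v m (y ⟨a + 1, Finset.mem_Iic.2 le_rfl⟩))) →
      Kernel.traj (X := fun _ => V) (stepKernel G) a x
        {ω | ∃ k, a < k ∧ k ≤ a + (m + 1) ∧ ω k = v} ≤
      ENNReal.ofReal (avg G (hitProb G v m) (x ⟨a, Finset.mem_Iic.2 le_rfl⟩)) := by
    intro m a x h
    rw [← Kernel.traj_comp_partialTraj (X := fun _ => V) (κ := stepKernel G) a.le_succ,
      Kernel.comp_apply' _ _ _ (measurableSet_visit v a (m + 1))]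
    refine (lintegral_mono h).trans ?_
    have hmap : ((Kernel.partialTraj (X := fun _ => V) (stepKernel G) a (a + 1)) x).map
        (fun y => y ⟨a + 1, Finset.mem_Iic.2 le_rfl⟩) = stepKernel G a x := by
      rw [← Kernel.map_apply _ (by fun_prop), Kernel.map_partialTraj_succ_self]
    rw [← lintegral_map (f := fun z => ENNReal.ofReal (hitProb G v m z))
      (g := fun y : (i : Finset.Iic (a + 1)) → (fun _ : ℕ => V) i =>
        y ⟨a + 1, Finset.mem_Iic.2 le_rfl⟩) Measurable.of_discrete (by fun_prop), hmap]
    exact (lintegral_stepPMF G (hG _) (hitProb_nonneg G v m)).le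
  induction m generalizing a with
  | zero =>
    refine step 0 a x fun y => ?_
    by_cases hy : y ⟨a + 1, Finset.mem_Iic.2 le_rfl⟩ = v
    · rw [hy, hitProb_self, ENNReal.ofReal_one]
      exact prob_le_one
    · refine le_of_eq_of_le ?_ zero_le
      refine measure_mono_null ?_ (traj_ne_eq_zero G y hy)
      rintro ω ⟨k, hk, hk', h⟩
      have : k = a + 1 := by omega
      subst this
      exact h
  | succ m ih =>
    refine step (m + 1) a x fun y => ?_
    by_cases hy : y ⟨a + 1, Finset.mem_Iic.2 le_rfl⟩ = v
    · rw [hy, hitProb_self, ENNReal.ofReal_one]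
      exact prob_le_one
    · rw [hitProb_succ_of_ne G hy]
      refine le_trans (measure_mono (t := {ω | ω (a + 1) = v} ∪
        {ω | ∃ k, a + 1 < k ∧ k ≤ a + 1 + (m + 1) ∧ ω k = v}) ?_)
        ((measure_union_le _ _).trans ?_)
      · rintro ω ⟨k, hk, hk', h⟩
        rcases Nat.lt_or_ge (a + 1) k with h1 | h1
        · exact Or.inr ⟨k, h1, by omega, h⟩
        · have : k = a + 1 := by omega
          subst this
          exact Or.inl h
      · rw [traj_ne_eq_zero G y hy, zero_add]
        exact ih (a + 1) y

lemma walkLaw_return_lt_one [Countable V] (hG : ∀ x, (G.neighborFinset x).Nonempty) {v : V}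
    {f : V → V → ℝ} (hf : IsUnitFlowToInfinity G v f) (hE : HasFiniteEnergy f) :
    walkLaw G v {ω | ∃ n : ℕ, 1 ≤ n ∧ ω n = v} < 1 := by
  obtain ⟨c, hc, h⟩ := exists_avg_hitProb_le G hf hE
  have hU : {ω : ℕ → V | ∃ n : ℕ, 1 ≤ n ∧ ω n = v} =
      ⋃ m : ℕ, {ω | ∃ k, 0 < k ∧ k ≤ 0 + (m + 1) ∧ ω k = v} := by
    ext ω
    simp only [Set.mem_ofPred_eq, Set.mem_iUnion]
    exact ⟨fun ⟨n, h1, h2⟩ => ⟨n, n, h1, by omega, h2⟩, fun ⟨_, n, h1, _, h2⟩ => ⟨n, h1, h2⟩⟩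
  have hmono : Monotone fun m : ℕ =>
      {ω : ℕ → V | ∃ k, 0 < k ∧ k ≤ 0 + (m + 1) ∧ ω k = v} := by
    rintro m m' hm ω ⟨k, h1, h2, h3⟩
    exact ⟨k, h1, by omega, h3⟩
  rw [hU, hmono.measure_iUnion]
  refine (iSup_le fun m => (traj_visit_le G hG v m 0 _).trans
    (ENNReal.ofReal_le_ofReal (h m))).trans_lt ?_
  rwa [ENNReal.ofReal_lt_one]

end Law

variable {G}

/-- A unit flow of finite energy can be rerouted to start at any reachable vertex. -/
lemma exists_flow_of_reachable {o v : V} (h : G.Reachable o v)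
    (hf : ∃ f, IsUnitFlowToInfinity G o f ∧ HasFiniteEnergy f) :
    ∃ f, IsUnitFlowToInfinity G v f ∧ HasFiniteEnergy f := by
  classical
  obtain ⟨p⟩ := h
  induction p with
  | nil => exact hf
  | @cons x y w hxy p ih =>
    refine ih ?_
    obtain ⟨f, hf, hE⟩ := hf
    -- One unit sent from `y` to `x` moves the source across the edge and alters the flow on that
    -- edge only.
    let g : V → V → ℝ := fun a b =>
      (if a = y ∧ b = x then 1 else 0) - (if a = x ∧ b = y then 1 else 0)
    refine ⟨fun a b => f a b + g a b, ⟨fun a b => ?_, fun a b hab => ?_, fun a => ?_⟩, ?_⟩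
    · simp only [g, hf.antisymm a b, and_comm (a := b = y), and_comm (a := b = x)]
      ring
    · have h1 : ¬ (a = y ∧ b = x) := by rintro ⟨rfl, rfl⟩; exact hab hxy.symm
      have h2 : ¬ (a = x ∧ b = y) := by rintro ⟨rfl, rfl⟩; exact hab hxy
      simp [g, h1, h2, hf.support a b hab]
    · rw [Finset.sum_add_distrib]
      have := hf.outflow a
      have hsum : ∑ b ∈ G.neighborFinset a, g a b =
          (if a = y then 1 else 0) - (if a = x then 1 else 0) := by
        simp only [g, Finset.sum_sub_distrib]
        congr 1
        · by_cases h : a = y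
          · subst h; simp [hxy.symm]
          · simp [h]
        · by_cases h : a = x
          · subst h; simp [hxy]
          · simp [h]
      rw [hsum]
      convert (congrArg (fun r : ℝ => r + ((if a = y then 1 else 0) - (if a = x then 1 else 0)))
        this) using 1
      ring
    · have hfin : (Function.support fun e : V × V => (f e.1 e.2 + g e.1 e.2) ^ 2 -
          f e.1 e.2 ^ 2).Finite := by
        refine (Set.toFinite {(y, x), (x, y)}).subset fun e he => ?_
        by_contra h
        simp only [Set.mem_insert_iff, Set.mem_singleton_iff, not_or, Prod.ext_iff] at h
        exact he (by simp [g, h.1, h.2])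
      have h2 := (summable_of_hasFiniteSupport hfin).add hE
      refine h2.congr fun e => ?_
      ring

/-- A connected graph carrying a unit flow to infinity of finite energy is transient. -/
theorem isTransient_of_flow [Countable V] (hG : G.Preconnected) {o : V}
    (hf : ∃ f, IsUnitFlowToInfinity G o f ∧ HasFiniteEnergy f) : IsTransient G := by
  intro v
  let _ : MeasurableSpace V := ⊤
  have hne : ∀ x, (G.neighborFinset x).Nonempty := by
    intro x
    obtain ⟨f, hf, -⟩ := exists_flow_of_reachable (hG o x) hf
    by_contra h
    have := hf.outflow x
    rw [Finset.not_nonempty_iff_eq_empty.1 h] at this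
    simp at this
  obtain ⟨f, hf, hE⟩ := exists_flow_of_reachable (hG o v) hf
  exact walkLaw_return_lt_one G hne hf hE

end FlowImpliesTransience

/-! ### Coordinates and connectedness of the souvlaki -/

section Coordinates

/-- `(n, i, j, k)` are the coordinates of a vertex of `M_n`: the pair of the `j`-th vertex of level
`i` of `H₂` and of the vertex `r_i^k` of `W`. -/
structure Valid (n i j k : ℕ) : Prop where
  one_le : 1 ≤ n
  height_le : i ≤ 2 ^ n
  lt : j < 3 ^ i
  le : k ≤ 2 ^ i * (3 * 2 ^ n)

/-- The vertex of `M_n` with given coordinates. -/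
def ballVert {n i j k : ℕ} (h : Valid n i j k) : ballSet n :=
  ⟨⟨(⟨i, ⟨j, h.lt⟩⟩, (i, (k : ℤ))), rfl⟩, h.height_le, Int.natCast_nonneg k,
    show (k : ℤ) ≤ 2 ^ i * (3 * 2 ^ n) by exact_mod_cast h.le⟩

open Classical in
/-- The vertex of `Ψ` with given coordinates in `M_n`; the root if the coordinates are invalid. -/
noncomputable def vtx (n i j k : ℕ) : PsiVert :=
  if h : Valid n i j k then glue n h.one_le (ballVert h) else root

/-- The coordinates of a vertex of `Ψ` off the skewer. -/
def coords : PsiVert → ℕ × ℕ × ℕ × ℕ :=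
  Sum.elim (fun _ => (0, 0, 0, 0)) fun v =>
    (v.1.1, v.1.2.1.1.1.1, v.1.2.1.1.1.2, v.1.2.1.1.2.2.toNat)

lemma Valid.vtx_eq {n i j k : ℕ} (h : Valid n i j k) :
    vtx n i j k = glue n h.one_le (ballVert h) := dif_pos h

lemma ballHeight_ballVert {n i j k : ℕ} (h : Valid n i j k) : ballHeight (ballVert h) = i := rfl

lemma vtx_zero {n j k : ℕ} (h : Valid n 0 j k) : vtx n 0 j k = Sum.inl (start n + k) := by
  rw [h.vtx_eq, glue, dif_neg (by simp [ballHeight_ballVert])]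
  rfl

lemma vtx_of_pos {n i j k : ℕ} (h : Valid n i j k) (hi : 0 < i) :
    vtx n i j k = Sum.inr ⟨⟨n, ballVert h⟩, h.one_le, hi⟩ := by
  rw [h.vtx_eq, glue, dif_pos (by simpa [ballHeight_ballVert] using hi)]

lemma vtx_of_not_valid {n i j k : ℕ} (h : ¬ Valid n i j k) : vtx n i j k = root := dif_neg h

lemma vtx_ne_inl {n i j k : ℕ} (h : Valid n i j k) (hi : 0 < i) (s : ℕ) :
    vtx n i j k ≠ Sum.inl s := by
  rw [vtx_of_pos h hi]
  exact Sum.inr_ne_inl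

lemma coords_vtx {n i j k : ℕ} (h : Valid n i j k) (hi : 0 < i) :
    coords (vtx n i j k) = (n, i, j, k) := by
  rw [vtx_of_pos h hi]
  rfl

lemma exists_eq_vtx (x : PsiVert) :
    (∃ s, x = Sum.inl s) ∨ ∃ n i j k, Valid n i j k ∧ 0 < i ∧ x = vtx n i j k := by
  rcases x with s | ⟨⟨n, ⟨⟨⟨⟨i, j⟩, ⟨i', k⟩⟩, hii⟩, h1, h2, h3⟩⟩, hn, hi⟩
  · exact Or.inl ⟨s, rfl⟩
  · right
    simp only [H2Vert.height, WVert.height] at hii h1 h2 h3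
    subst hii
    lift k to ℕ using h2
    have hv : Valid n i j k := ⟨hn, h1, j.2, by exact_mod_cast h3⟩
    exact ⟨n, i, j, k, hv, hi, (vtx_of_pos hv hi).symm⟩

/-- Positive height is essential: a skewer vertex has coordinates in several meatballs. -/
lemma vtx_eq_vtx {n i j k n' i' j' k' : ℕ} (h : Valid n i j k) (hi : 0 < i)
    (h' : Valid n' i' j' k') (he : vtx n i j k = vtx n' i' j' k') :
    n = n' ∧ i = i' ∧ j = j' ∧ k = k' := by
  rcases Nat.eq_zero_or_pos i' with rfl | hi'
  · rw [vtx_zero h'] at he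
    exact absurd he (vtx_ne_inl h hi _)
  · have := congrArg coords he
    rw [coords_vtx h hi, coords_vtx h' hi'] at this
    simpa using this

lemma psi_adj_of_adj {n i j k i' j' k' : ℕ} (h : Valid n i j k) (h' : Valid n i' j' k')
    (hne : vtx n i j k ≠ vtx n i' j' k') (hadj : H3.Adj (ballVert h).1 (ballVert h').1) :
    Psi.Adj (vtx n i j k) (vtx n i' j' k') := by
  rw [h.vtx_eq, h'.vtx_eq] at hne ⊢
  rw [Psi, SimpleGraph.sup_adj]
  right
  simp only [SimpleGraph.iSup_adj]
  exact ⟨n, h.one_le, hne, ballVert h, ballVert h', hadj, rfl, rfl⟩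

lemma Valid.parent {n i j k : ℕ} (h : Valid n (i + 1) j k) : Valid n i (j / 3) (k / 2) where
  one_le := h.one_le
  height_le := (Nat.le_succ i).trans h.height_le
  lt := by have := h.lt; rw [pow_succ] at this; omega
  le := by
    have := h.le
    rw [pow_succ, mul_assoc, mul_left_comm] at this
    omega

/-- A diagonal edge of `H3`: both factors change level. The position in `W` must be even, since only
r_{i+1}^{2k} has a neighbour in D_i. -/
lemma psi_adj_parent {n i j k : ℕ} (h : Valid n (i + 1) j (2 * k)) :
    Psi.Adj (vtx n i (j / 3) k) (vtx n (i + 1) j (2 * k)) := by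
  have h' : Valid n i (j / 3) k := by
    have := h.parent
    rwa [Nat.mul_div_cancel_left _ two_pos] at this
  refine psi_adj_of_adj h' h (fun he => ?_) (Or.inl ⟨?_, ?_⟩)
  · have := (vtx_eq_vtx h i.succ_pos h' he.symm).2.1
    omega
  · exact Or.inl (by simp [T3, ballVert])
  · simp [W, ballVert]

lemma psi_adj_right {n i j k : ℕ} (h : Valid n i j (k + 1)) :
    Psi.Adj (vtx n i j k) (vtx n i j (k + 1)) := by
  have h' : Valid n i j k := ⟨h.one_le, h.height_le, h.lt, (Nat.le_succ k).trans h.le⟩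
  refine psi_adj_of_adj h' h (fun he => ?_) (Or.inr (Or.inr ⟨rfl, ?_⟩))
  · rcases Nat.eq_zero_or_pos i with rfl | hi
    · rw [vtx_zero h, vtx_zero h', Sum.inl.injEq] at he
      omega
    · have := (vtx_eq_vtx h hi h' he.symm).2.2.2
      omega
  · simp [W, ballVert]

lemma psi_reachable_root (x : PsiVert) : Psi.Reachable root x := by
  have hskewer : ∀ s : ℕ, Psi.Reachable root (Sum.inl s) := by
    intro s
    induction s with
    | zero => exact SimpleGraph.Reachable.refl _
    | succ s ih =>
      refine ih.trans (SimpleGraph.Adj.reachable ?_)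
      rw [Psi, SimpleGraph.sup_adj]
      exact Or.inl ⟨by simp, s, s + 1, by simp [SimpleGraph.hasse_adj], rfl, rfl⟩
  rcases exists_eq_vtx x with ⟨s, rfl⟩ | ⟨n, i, j, k, h, -, rfl⟩
  · exact hskewer s
  -- Move left to position 0, which is even at every level, then straight down to the skewer.
  · induction k with
    | succ k ih =>
      exact (ih ⟨h.one_le, h.height_le, h.lt, (Nat.le_succ k).trans h.le⟩).trans
        (psi_adj_right h).reachable
    | zero =>
      induction i generalizing j with
      | zero => rw [vtx_zero h]; exact hskewer _
      | succ i ih => exact (ih _ h.parent).trans (psi_adj_parent h).reachable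

lemma psi_preconnected : Psi.Preconnected := fun x y =>
  (psi_reachable_root x).symm.trans (psi_reachable_root y)

instance : Countable PsiVert := by
  infer_instance

end Coordinates

/-! ### Flows along a map, and their energy -/

section EdgeFlow

variable {V : Type*}

open Classical in
/-- The antisymmetric function that sends the amount `w x` along the edge from `x` to `φ x`. -/
noncomputable def edgeFlow (φ : V → V) (w : V → ℝ) (x y : V) : ℝ :=
  (if φ x = y then w x else 0) - (if φ y = x then w y else 0)

lemma edgeFlow_antisymm (φ : V → V) (w : V → ℝ) (x y : V) :
    edgeFlow φ w y x = - edgeFlow φ w x y := by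
  simp [edgeFlow]

lemma edgeFlow_eq_zero {G : SimpleGraph V} {φ : V → V} {w : V → ℝ}
    (h : ∀ x, w x ≠ 0 → G.Adj x (φ x)) {x y : V} (hxy : ¬ G.Adj x y) : edgeFlow φ w x y = 0 := by
  have h1 : φ x = y → w x = 0 := fun e => by
    by_contra hw; exact hxy (e ▸ h x hw)
  have h2 : φ y = x → w y = 0 := fun e => by
    by_contra hw; exact hxy (e ▸ h y hw).symm
  unfold edgeFlow
  split_ifs with h3 h4 h4 <;> simp [*]

/-- The family `e` on `S` lists, without repetition, the vertices that send a nonzero amount to `x`;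
it may also contain vertices of weight zero. -/
lemma outflow_edgeFlow {G : SimpleGraph V} [G.LocallyFinite] {φ : V → V} {w : V → ℝ}
    (h : ∀ x, w x ≠ 0 → G.Adj x (φ x)) (x : V) {ι : Type*} (S : Finset ι) (e : ι → V)
    (he : Set.InjOn e S) (hφ : ∀ s ∈ S, w (e s) ≠ 0 → φ (e s) = x)
    (hS : ∀ y, w y ≠ 0 → φ y = x → ∃ s ∈ S, e s = y) :
    ∑ y ∈ G.neighborFinset x, edgeFlow φ w x y = w x - ∑ s ∈ S, w (e s) := by
  classical
  simp only [edgeFlow, Finset.sum_sub_distrib]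
  congr 1
  · rw [Finset.sum_ite_eq]
    split_ifs with hx
    · rfl
    · by_contra hw
      exact hx (by simpa using h x (Ne.symm hw))
  · symm
    refine Finset.sum_bij_ne_zero (fun s _ _ => e s) (fun s hs hw => ?_)
      (fun s hs _ t ht _ hst => he hs ht hst) (fun y hy hw => ?_) (fun s hs hw => ?_)
    · have := h _ hw
      rw [hφ s hs hw] at this
      simpa using this.symm
    · obtain ⟨hx, hw⟩ := ite_ne_right_iff.1 hw
      obtain ⟨s, hs, rfl⟩ := hS y hw hx
      exact ⟨s, hs, hw, rfl⟩
    · rw [if_pos (hφ s hs hw)]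

lemma HasFiniteEnergy.add {f g : V → V → ℝ} (hf : HasFiniteEnergy f) (hg : HasFiniteEnergy g) :
    HasFiniteEnergy fun x y => f x y + g x y :=
  Summable.of_nonneg_of_le (fun _ => sq_nonneg _) (fun _ => add_sq_le)
    ((Summable.add hf hg).mul_left 2)

lemma HasFiniteEnergy.neg {f : V → V → ℝ} (hf : HasFiniteEnergy f) :
    HasFiniteEnergy fun x y => - f x y :=
  Summable.congr hf fun _ => by ring

lemma HasFiniteEnergy.swap {f : V → V → ℝ} (hf : HasFiniteEnergy f) :
    HasFiniteEnergy fun x y => f y x :=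
  (Equiv.prodComm V V).summable_iff.2 hf

lemma hasFiniteEnergy_edgeFlow (φ : V → V) {w : V → ℝ} (hw : Summable fun x => w x ^ 2) :
    HasFiniteEnergy (edgeFlow φ w) := by
  classical
  have h : HasFiniteEnergy fun x y => if φ x = y then w x else 0 := by
    have hinj : Function.Injective fun x => (x, φ x) := fun x y hxy => (Prod.ext_iff.1 hxy).1
    refine (hinj.summable_iff fun e he => ?_).1 (hw.congr fun x => by simp)
    have : φ e.1 ≠ e.2 := fun h => he ⟨e.1, by simp [h]⟩
    simp [this]
  exact (h.add h.swap.neg).congr fun e => by simp only [edgeFlow]; ring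

/-- A nonnegative function is summable if its support is covered by finite levels on which it is
bounded, with summable products of sizes and bounds. -/
lemma summable_of_levels {ι : Type*} (κ : ι → Type*) [∀ p, Fintype (κ p)] (e : ∀ p, κ p → V)
    (b : ι → ℝ) {h : V → ℝ} (h0 : ∀ x, 0 ≤ h x) (hb : ∀ p q, h (e p q) ≤ b p)
    (hs : ∀ x, h x ≠ 0 → ∃ p q, e p q = x) (hsum : Summable fun p => Fintype.card (κ p) * b p) :
    Summable h := by
  have h1 : Summable fun z : Σ p, κ p => h (e z.1 z.2) := by
    rw [summable_sigma_of_nonneg fun z => h0 _]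
    refine ⟨fun p => Summable.of_finite, ?_⟩
    refine Summable.of_nonneg_of_le (fun p => tsum_nonneg fun _ => h0 _) (fun p => ?_) hsum
    rw [tsum_fintype]
    refine (Finset.sum_le_sum fun q _ => hb p q).trans ?_
    simp
  have h2 : ∀ x : Function.support h, ∃ z : Σ p, κ p, e z.1 z.2 = x := fun x => by
    obtain ⟨p, q, hpq⟩ := hs x x.2
    exact ⟨⟨p, q⟩, hpq⟩
  choose r hr using h2
  have hinj : Function.Injective r := fun x y hxy => Subtype.ext (by rw [← hr x, ← hr y, hxy])
  have h3 := h1.comp_injective hinj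
  refine (Subtype.val_injective.summable_iff fun x hx => ?_).1
    (h3.congr fun x : Function.support h => congrArg h (hr x))
  simpa using hx

end EdgeFlow

/-! ### Amounts exchanged between the skewer and the meatballs -/

section Amounts

lemma start_succ {n : ℕ} (hn : 1 ≤ n) : start (n + 1) = start n + 2 ^ n + 1 := by
  rw [start, Finset.sum_Ico_succ_top hn, start, add_assoc]

lemma start_one : start 1 = 0 := by simp [start]

lemma le_start_succ (n : ℕ) : n ≤ start (n + 1) := by
  induction n with
  | zero => simp
  | succ n ih => have := Nat.two_pow_pos (n + 1); rw [start_succ (by omega)]; omega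

/-- The distribution on the skewer of the flow entering `M_n`: the point mass at the root for
`n = 1`, and the uniform distribution on `L_n` for `n ≥ 2`. -/
noncomputable def entry (n s : ℕ) : ℝ :=
  if n = 1 then (if s = 0 then 1 else 0)
  else if start n ≤ s ∧ s < start n + 2 ^ n then (2 ^ n)⁻¹ else 0

/-- The net amount that enters `M_n` from the vertex `s` of the skewer. -/
noncomputable def supply (n s : ℕ) : ℝ := entry n s - entry (n + 1) s

/-- The net amount that enters `M_n` from its first `m` vertices on the skewer. -/
noncomputable def cumul (n m : ℕ) : ℝ := ∑ x ∈ Finset.range m, supply n (start n + x)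

lemma entry_one (s : ℕ) : entry 1 s = if s = 0 then 1 else 0 := if_pos rfl

lemma entry_nonneg (n s : ℕ) : 0 ≤ entry n s := by
  unfold entry
  split_ifs <;> positivity

/-- The factor 2 accommodates the point mass at `n = 1`. -/
lemma entry_le (n s : ℕ) : entry n s ≤ 2 / 2 ^ n := by
  unfold entry
  split_ifs with h h' h'
  · subst h; norm_num
  · positivity
  · rw [div_eq_mul_inv]
    exact le_mul_of_one_le_left (by positivity) (by norm_num)
  · positivity

lemma entry_eq_zero {n s : ℕ} (h : ¬ (start n ≤ s ∧ s < start n + 2 ^ n)) : entry n s = 0 := by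
  unfold entry
  split_ifs with h1 h2
  · subst h1 h2
    simp [start_one] at h
  · rfl
  · rfl

lemma sum_entry {n a m : ℕ} (ha : a ≤ start n) (hm : start n + 2 ^ n ≤ a + m) :
    ∑ x ∈ Finset.range m, entry n (a + x) = 1 := by
  have h1 := Finset.sum_Ico_eq_sum_range (entry n) a (a + m)
  rw [Nat.add_sub_cancel_left] at h1
  rw [← h1, ← Finset.sum_subset (s₁ := Finset.Ico (start n) (start n + 2 ^ n))]
  · by_cases hn : n = 1
    · subst hn
      simp [start_one, entry_one]
    · have : ∀ s ∈ Finset.Ico (start n) (start n + 2 ^ n), entry n s = (2 ^ n)⁻¹ := by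
        intro s hs
        rw [Finset.mem_Ico] at hs
        rw [entry, if_neg hn, if_pos hs]
      rw [Finset.sum_congr rfl this]
      simp
  · exact Finset.Ico_subset_Ico ha hm
  · intro s _ hs
    exact entry_eq_zero (by simpa using hs)

lemma sum_entry_le {n a : ℕ} (ha : a ≤ start n) (m : ℕ) :
    ∑ x ∈ Finset.range m, entry n (a + x) ≤ 1 := by
  have := Nat.two_pow_pos n
  rw [← sum_entry (m := m + (start n + 2 ^ n)) ha (by omega)]
  exact Finset.sum_le_sum_of_subset_of_nonneg
    (Finset.range_subset_range.2 (by omega)) fun _ _ _ => entry_nonneg _ _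

lemma abs_supply_le (n s : ℕ) : |supply n s| ≤ 2 / 2 ^ n := by
  have h : (2 : ℝ) / 2 ^ (n + 1) ≤ 2 / 2 ^ n := by
    gcongr <;> norm_num
  unfold supply
  rw [abs_le]
  constructor <;> linarith [entry_nonneg n s, entry_le n s, entry_nonneg (n + 1) s,
    entry_le (n + 1) s]

lemma supply_eq_zero {n s : ℕ} (hn : 1 ≤ n) (h : ¬ (start n ≤ s ∧ s ≤ start n + 3 * 2 ^ n)) :
    supply n s = 0 := by
  have h1 := start_succ hn
  have h2 : 2 ^ (n + 1) = 2 ^ n * 2 := pow_succ 2 n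
  rw [supply, entry_eq_zero (by omega), entry_eq_zero (by omega), sub_zero]

lemma cumul_succ (n m : ℕ) : cumul n (m + 1) = cumul n m + supply n (start n + m) :=
  Finset.sum_range_succ _ _

lemma cumul_zero (n : ℕ) : cumul n 0 = 0 := rfl

lemma cumul_eq (n m : ℕ) : cumul n m = ∑ x ∈ Finset.range m, entry n (start n + x) -
    ∑ x ∈ Finset.range m, entry (n + 1) (start n + x) := Finset.sum_sub_distrib _ _

lemma abs_cumul_le {n : ℕ} (hn : 1 ≤ n) (m : ℕ) : |cumul n m| ≤ 1 := by
  have h1 := start_succ hn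
  have hp := Nat.two_pow_pos n
  rw [cumul_eq, abs_le]
  have h2 := sum_entry_le (le_refl (start n)) m
  have h3 := sum_entry_le (show start n ≤ start (n + 1) by omega) m
  have h4 : 0 ≤ ∑ x ∈ Finset.range m, entry n (start n + x) :=
    Finset.sum_nonneg fun _ _ => entry_nonneg _ _
  have h5 : 0 ≤ ∑ x ∈ Finset.range m, entry (n + 1) (start n + x) :=
    Finset.sum_nonneg fun _ _ => entry_nonneg _ _
  constructor <;> linarith

/-- Over all `3 * 2 ^ n + 1` skewer vertices of M_n, one unit enters and one unit leaves. -/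
lemma cumul_top {n : ℕ} (hn : 1 ≤ n) : cumul n (3 * 2 ^ n + 1) = 0 := by
  have h1 := start_succ hn
  have h2 : 2 ^ (n + 1) = 2 ^ n * 2 := pow_succ 2 n
  rw [cumul_eq, sum_entry le_rfl (by omega), sum_entry (by omega) (by omega), sub_self]

/-- The sum telescopes, and L_{s+2} begins beyond `s`. -/
lemma sum_supply (s : ℕ) :
    ∑ n ∈ Finset.Icc 1 (s + 1), supply n s = if s = 0 then 1 else 0 := by
  have h : ∀ b, ∑ n ∈ Finset.Icc 1 b, supply n s = entry 1 s - entry (b + 1) s := by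
    intro b
    induction b with
    | zero => simp
    | succ b ih => rw [Finset.sum_Icc_succ_top (by omega), ih, supply]; ring
  have := le_start_succ (s + 1)
  rw [h, entry_one, entry_eq_zero (n := s + 1 + 1) (by omega), sub_zero]

end Amounts

/-! ### The flow and its energy -/

section Flow

/-- The vertex below a vertex of `M_n`. -/
noncomputable def below (x : PsiVert) : PsiVert :=
  vtx (coords x).1 ((coords x).2.1 - 1) ((coords x).2.2.1 / 3) ((coords x).2.2.2 / 2)

/-- The right neighbour of a vertex of `M_n` in its level. -/
noncomputable def right (x : PsiVert) : PsiVert :=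
  vtx (coords x).1 (coords x).2.1 (coords x).2.2.1 ((coords x).2.2.2 + 1)

/-- The amount of flow that descends from a vertex of `M_n` to the vertex below: the supply of
each vertex of the skewer climbs straight up, spreading evenly over the vertices above it. -/
noncomputable def descent (x : PsiVert) : ℝ :=
  if 0 < (coords x).2.1 ∧ 2 ^ (coords x).2.1 ∣ (coords x).2.2.2 then
    - supply (coords x).1 (start (coords x).1 + (coords x).2.2.2 / 2 ^ (coords x).2.1) /
      3 ^ (coords x).2.1
  else 0

/-- The amount of flow from a vertex of the top level of `M_n` to its right neighbour. -/
noncomputable def drift (x : PsiVert) : ℝ :=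
  if 0 < (coords x).2.1 ∧ (coords x).2.1 = 2 ^ (coords x).1 then
    -- The `+ 1` includes the column at or immediately left of the present position.
    cumul (coords x).1 ((coords x).2.2.2 / 2 ^ (coords x).2.1 + 1) / 3 ^ (coords x).2.1
  else 0

lemma descent_inl (s : ℕ) : descent (Sum.inl s) = 0 := by simp [descent, coords]

lemma drift_inl (s : ℕ) : drift (Sum.inl s) = 0 := by simp [drift, coords]

section Vtx

variable {n i j k : ℕ}

lemma below_vtx (h : Valid n (i + 1) j k) :
    below (vtx n (i + 1) j k) = vtx n i (j / 3) (k / 2) := by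
  simp [below, coords_vtx h]

lemma right_vtx (h : Valid n i j k) (hi : 0 < i) :
    right (vtx n i j k) = vtx n i j (k + 1) := by
  simp [right, coords_vtx h hi]

lemma descent_vtx (h : Valid n i j k) (hi : 0 < i) : descent (vtx n i j k) =
    if 2 ^ i ∣ k then - supply n (start n + k / 2 ^ i) / 3 ^ i else 0 := by
  simp [descent, coords_vtx h hi, hi]

lemma drift_vtx (h : Valid n i j k) (hi : 0 < i) : drift (vtx n i j k) =
    if i = 2 ^ n then cumul n (k / 2 ^ i + 1) / 3 ^ i else 0 := by
  simp [drift, coords_vtx h hi, hi]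

end Vtx

lemma exists_of_descent_ne_zero {y : PsiVert} (hy : descent y ≠ 0) :
    ∃ n i j k, Valid n (i + 1) j (2 * k) ∧ y = vtx n (i + 1) j (2 * k) ∧
      below y = vtx n i (j / 3) k ∧ 2 ^ i ∣ k := by
  rcases exists_eq_vtx y with ⟨s, rfl⟩ | ⟨n, i, j, k, h, hi, rfl⟩
  · exact absurd (descent_inl s) hy
  · obtain ⟨i, rfl⟩ := Nat.exists_eq_succ_of_ne_zero hi.ne'
    rw [descent_vtx h hi] at hy
    have hd := (ite_ne_right_iff.1 hy).1
    rw [Nat.succ_eq_add_one, pow_succ'] at hd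
    obtain ⟨k, rfl⟩ := (Dvd.intro _ rfl).trans hd
    refine ⟨n, i, j, k, h, rfl, ?_, Nat.dvd_of_mul_dvd_mul_left two_pos hd⟩
    rw [below_vtx h, Nat.mul_div_cancel_left _ two_pos]

lemma exists_of_drift_ne_zero {y : PsiVert} (hy : drift y ≠ 0) :
    ∃ n j k, Valid n (2 ^ n) j (k + 1) ∧ Valid n (2 ^ n) j k ∧ y = vtx n (2 ^ n) j k ∧
      right y = vtx n (2 ^ n) j (k + 1) := by
  rcases exists_eq_vtx y with ⟨s, rfl⟩ | ⟨n, i, j, k, h, hi, rfl⟩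
  · exact absurd (drift_inl s) hy
  · rw [drift_vtx h hi] at hy
    obtain ⟨rfl, hc⟩ := ite_ne_right_iff.1 hy
    refine ⟨n, j, k, ⟨h.one_le, h.height_le, h.lt, lt_of_le_of_ne h.le ?_⟩, h, rfl,
      right_vtx h hi⟩
    rintro rfl
    -- At the right end everything has been returned, so the drift never needs a further edge.
    rw [Nat.mul_div_cancel_left _ (by positivity), cumul_top h.one_le, zero_div] at hc
    exact hc rfl

lemma psi_adj_below {x : PsiVert} (hx : descent x ≠ 0) : Psi.Adj x (below x) := by
  obtain ⟨n, i, j, k, h, rfl, hb, -⟩ := exists_of_descent_ne_zero hx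
  rw [hb]
  exact (psi_adj_parent h).symm

lemma psi_adj_of_drift {x : PsiVert} (hx : drift x ≠ 0) : Psi.Adj x (right x) := by
  obtain ⟨n, j, k, h, -, rfl, hb⟩ := exists_of_drift_ne_zero hx
  rw [hb]
  exact psi_adj_right h

/-- Below the top, the three vertices above carry a third each of what passes through. At the top
nothing lies above, and the excess is left for the drift. -/
lemma outflow_descent_vtx {n i j k : ℕ} (h : Valid n i j k) (hi : 0 < i) :
    ∑ y ∈ Psi.neighborFinset (vtx n i j k), edgeFlow below descent (vtx n i j k) y =
      if i = 2 ^ n ∧ 2 ^ i ∣ k then - supply n (start n + k / 2 ^ i) / 3 ^ i else 0 := by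
  by_cases hin : i = 2 ^ n
  · rw [outflow_edgeFlow (fun x => psi_adj_below) _ (∅ : Finset ℕ) (fun _ => root) (by simp)
      (by simp), descent_vtx h hi]
    · simp [hin]
    · intro y hy hyx
      obtain ⟨n', i', j', k', h', rfl, hb, -⟩ := exists_of_descent_ne_zero hy
      rw [hb] at hyx
      have hv := h'.parent
      rw [Nat.mul_div_cancel_left _ two_pos] at hv
      obtain ⟨rfl, rfl, -, -⟩ := vtx_eq_vtx h hi hv hyx.symm
      have := h'.height_le
      omega
  · have hlt : i + 1 ≤ 2 ^ n := lt_of_le_of_ne h.height_le hin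
    have hv : ∀ d < 3, Valid n (i + 1) (3 * j + d) (2 * k) := fun d hd =>
      ⟨h.one_le, hlt, by have := h.lt; rw [pow_succ]; omega, by
        have := h.le; rw [pow_succ, mul_assoc, mul_left_comm]; omega⟩
    rw [outflow_edgeFlow (fun x => psi_adj_below) _ (Finset.range 3)
      (fun d => vtx n (i + 1) (3 * j + d) (2 * k)), descent_vtx h hi,
      if_neg (c := i = 2 ^ n ∧ 2 ^ i ∣ k) fun h => hin h.1]
    · have : ∀ d ∈ Finset.range 3, descent (vtx n (i + 1) (3 * j + d) (2 * k)) =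
          (if 2 ^ i ∣ k then - supply n (start n + k / 2 ^ i) / 3 ^ i else 0) / 3 := by
        intro d hd
        rw [descent_vtx (hv d (Finset.mem_range.1 hd)) i.succ_pos]
        simp only [pow_succ', Nat.mul_dvd_mul_iff_left two_pos, Nat.mul_div_mul_left _ _ two_pos]
        split_ifs
        · field_simp
        · simp
      rw [Finset.sum_congr rfl this, Finset.sum_const, Finset.card_range, nsmul_eq_mul]
      push_cast
      ring
    · intro d hd d' hd' hdd
      simp only [Finset.coe_range, Set.mem_Iio] at hd hd'
      have := (vtx_eq_vtx (hv d hd) i.succ_pos (hv d' hd') hdd).2.2.1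
      omega
    · intro d hd _
      rw [below_vtx (hv d (Finset.mem_range.1 hd)), Nat.mul_div_cancel_left _ two_pos]
      have : (3 * j + d) / 3 = j := by rw [Finset.mem_range] at hd; omega
      rw [this]
    · intro y hy hyx
      obtain ⟨n', i', j', k', h', rfl, hb, -⟩ := exists_of_descent_ne_zero hy
      rw [hb] at hyx
      have hv := h'.parent
      rw [Nat.mul_div_cancel_left _ two_pos] at hv
      obtain ⟨rfl, rfl, rfl, rfl⟩ := vtx_eq_vtx h hi hv hyx.symm
      refine ⟨j' % 3, Finset.mem_range.2 (Nat.mod_lt _ (by norm_num)), ?_⟩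
      rw [Nat.div_add_mod]

lemma outflow_descent_inl (s : ℕ) :
    ∑ y ∈ Psi.neighborFinset (Sum.inl s), edgeFlow below descent (Sum.inl s) y =
      if s = 0 then 1 else 0 := by
  -- All meatballs through `s` have index at most `s + 1`, as `n ≤ start (n + 1)`. The filter keeps
  -- the truncated subtraction `s - start p.1` exact.
  let S : Finset (ℕ × ℕ) := (Finset.Icc 1 (s + 1) ×ˢ Finset.range 3).filter
    fun p => start p.1 ≤ s ∧ s ≤ start p.1 + 3 * 2 ^ p.1
  have hv : ∀ p ∈ S, Valid p.1 1 p.2 (2 * (s - start p.1)) := by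
    intro p hp
    simp only [S, Finset.mem_filter, Finset.mem_product, Finset.mem_Icc, Finset.mem_range] at hp
    exact ⟨hp.1.1.1, Nat.one_le_two_pow, by omega, by omega⟩
  rw [outflow_edgeFlow (fun x => psi_adj_below) _ S
    (fun p => vtx p.1 1 p.2 (2 * (s - start p.1))), descent_inl, zero_sub]
  · have : ∀ p ∈ S, descent (vtx p.1 1 p.2 (2 * (s - start p.1))) = - supply p.1 s / 3 := by
      intro p hp
      rw [descent_vtx (hv p hp) one_pos]
      simp only [S, Finset.mem_filter] at hp
      simp [hp.2.1]
    rw [Finset.sum_congr rfl this, ← sum_supply, Finset.sum_filter_of_ne, Finset.sum_product]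
    · simp only [Finset.sum_const, Finset.card_range, nsmul_eq_mul, ← Finset.sum_neg_distrib]
      refine Finset.sum_congr rfl fun n _ => ?_
      push_cast
      ring
    · intro p hp hne
      by_contra hc
      simp only [Finset.mem_product, Finset.mem_Icc] at hp
      rw [supply_eq_zero hp.1.1 hc, neg_zero, zero_div] at hne
      exact hne rfl
  · intro p hp q hq hpq
    obtain ⟨h1, -, h2, -⟩ := vtx_eq_vtx (hv p hp) one_pos (hv q hq) hpq
    exact Prod.ext h1 h2
  · intro p hp _
    have h1 := hv p hp
    have h2 := h1.parent
    simp only [S, Finset.mem_filter] at hp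
    rw [below_vtx h1]
    rw [Nat.mul_div_cancel_left _ two_pos] at h2 ⊢
    rw [vtx_zero h2, Nat.add_sub_cancel' hp.2.1]
  · intro y hy hys
    obtain ⟨n, i, j, k, h, rfl, hb, -⟩ := exists_of_descent_ne_zero hy
    have hvk := h.parent
    rw [Nat.mul_div_cancel_left _ two_pos] at hvk
    rw [hb] at hys
    rcases Nat.eq_zero_or_pos i with rfl | hi
    · rw [vtx_zero hvk, Sum.inl.injEq] at hys
      subst hys
      refine ⟨(n, j), ?_, by simp⟩
      have h1 := h.one_le
      have h2 := hvk.le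
      have h3 := h.lt
      obtain ⟨m, rfl⟩ := Nat.exists_eq_add_of_le' h1
      have h4 := le_start_succ m
      simp only [S, Finset.mem_filter, Finset.mem_product, Finset.mem_Icc, Finset.mem_range]
      omega
    · exact absurd hys (vtx_ne_inl hvk hi s)

/-- Consecutive values of `cumul` differ by the supply of a column, and the quotient `k / 2 ^ i`
jumps exactly at columns. This cancels the excess of the descent. -/
lemma outflow_drift_vtx {n i j k : ℕ} (h : Valid n i j k) (hi : 0 < i) :
    ∑ y ∈ Psi.neighborFinset (vtx n i j k), edgeFlow right drift (vtx n i j k) y =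
      if i = 2 ^ n ∧ 2 ^ i ∣ k then supply n (start n + k / 2 ^ i) / 3 ^ i else 0 := by
  rcases k with _ | k
  · rw [outflow_edgeFlow (fun x => psi_adj_of_drift) _ (∅ : Finset ℕ) (fun _ => root) (by simp)
      (by simp), drift_vtx h hi]
    · simp [cumul_succ, cumul_zero]
    · intro y hy hyx
      obtain ⟨n', j', k', h', -, rfl, hb⟩ := exists_of_drift_ne_zero hy
      rw [hb] at hyx
      have := (vtx_eq_vtx h hi h' hyx.symm).2.2.2
      omega
  · have h0 : Valid n i j k := ⟨h.one_le, h.height_le, h.lt, (Nat.le_succ k).trans h.le⟩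
    rw [outflow_edgeFlow (fun x => psi_adj_of_drift) _ (Finset.range 1) (fun _ => vtx n i j k),
      drift_vtx h hi, Finset.sum_range_one, drift_vtx h0 hi, Nat.succ_div]
    · by_cases hin : i = 2 ^ n <;> by_cases hd : 2 ^ i ∣ k + 1
      · simp only [hin, if_true, true_and]
        rw [hin] at hd
        simp only [hd, if_true]
        rw [cumul_succ n (k / _ + 1)]
        ring
      · rw [if_neg hd]
        simp [hd]
      · simp [hin]
      · simp [hin]
    · simp
    · intro _ _ _
      exact right_vtx h0 hi
    · intro y hy hyx
      obtain ⟨n', j', k', h', -, rfl, hb⟩ := exists_of_drift_ne_zero hy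
      rw [hb] at hyx
      obtain ⟨rfl, rfl, rfl, hk⟩ := vtx_eq_vtx h hi h' hyx.symm
      obtain rfl : k = k' := by omega
      exact ⟨0, by simp, rfl⟩

lemma outflow_drift_inl (s : ℕ) :
    ∑ y ∈ Psi.neighborFinset (Sum.inl s), edgeFlow right drift (Sum.inl s) y = 0 := by
  rw [outflow_edgeFlow (fun x => psi_adj_of_drift) _ (∅ : Finset ℕ) (fun _ => root) (by simp)
    (by simp), drift_inl, Finset.sum_empty, sub_zero]
  intro y hy hyx
  obtain ⟨n, j, k, h, -, rfl, hb⟩ := exists_of_drift_ne_zero hy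
  exact absurd (hb.symm.trans hyx) (vtx_ne_inl h (by positivity) s)

lemma summable_descent_sq : Summable fun x => descent x ^ 2 := by
  refine summable_of_levels (fun p : ℕ × ℕ => Fin (3 ^ p.2) × Fin (3 * 2 ^ p.1 + 1))
    (fun p q => vtx p.1 p.2 q.1 (2 ^ p.2 * q.2)) (fun p => 4 / (4 ^ p.1 * 9 ^ p.2))
    (fun _ => sq_nonneg _) ?_ ?_ ?_
  · rintro ⟨n, i⟩ ⟨j, x⟩
    by_cases h : Valid n i j (2 ^ i * x)
    · rcases Nat.eq_zero_or_pos i with rfl | hi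
      · rw [vtx_zero h, descent_inl, zero_pow two_ne_zero]
        positivity
      · rw [descent_vtx h hi, if_pos (Dvd.intro _ rfl), div_pow, neg_sq, ← sq_abs,
          ← div_div, pow_right_comm 3 i 2]
        have := pow_le_pow_left₀ (abs_nonneg _)
          (abs_supply_le n (start n + 2 ^ i * x / 2 ^ i)) 2
        rw [div_pow, pow_right_comm 2 n 2] at this
        norm_num at this ⊢
        gcongr
    -- Invalid coordinates denote the root, where the descent vanishes.
    · rw [vtx_of_not_valid h, root, descent_inl, zero_pow two_ne_zero]
      positivity
  · intro x hx
    obtain ⟨n, i, j, k, h, rfl, -, m, rfl⟩ :=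
      exists_of_descent_ne_zero (y := x) (fun h0 => hx (by simp [h0]))
    have he : 2 ^ (i + 1) * m = 2 * (2 ^ i * m) := by rw [pow_succ']; ring
    have hm : m < 3 * 2 ^ n + 1 := by
      have := h.le
      rw [← he] at this
      exact Nat.lt_succ_of_le (Nat.le_of_mul_le_mul_left this (by positivity))
    exact ⟨(n, i + 1), (⟨j, h.lt⟩, ⟨m, hm⟩), by simp only [he]⟩
  -- The constant is 16 = 4 · 4: `3 * 2 ^ n + 1 ≤ 4 * 2 ^ n`, and 4 is the square of the 2 in
  -- `abs_supply_le`.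
  · refine Summable.of_nonneg_of_le (fun p => by positivity) (fun p => ?_)
      (((summable_geometric_of_lt_one (r := (1 / 2 : ℝ)) (by norm_num) (by norm_num)).mul_of_nonneg
        (summable_geometric_of_lt_one (r := (1 / 3 : ℝ)) (by norm_num) (by norm_num))
        (fun _ => by positivity) (fun _ => by positivity)).mul_left 16)
    simp only [Fintype.card_prod, Fintype.card_fin]
    push_cast
    have h1 : (1 : ℝ) ≤ 2 ^ p.1 := one_le_pow₀ (by norm_num)
    have h4 : (4 : ℝ) ^ p.1 = 2 ^ p.1 * 2 ^ p.1 := by rw [← mul_pow]; norm_num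
    have h9 : (9 : ℝ) ^ p.2 = 3 ^ p.2 * 3 ^ p.2 := by rw [← mul_pow]; norm_num
    rw [h4, h9, one_div_pow, one_div_pow]
    have : (3 : ℝ) * 2 ^ p.1 + 1 ≤ 4 * 2 ^ p.1 := by linarith
    calc (3 : ℝ) ^ p.2 * (3 * 2 ^ p.1 + 1) * (4 / (2 ^ p.1 * 2 ^ p.1 * (3 ^ p.2 * 3 ^ p.2)))
        ≤ 3 ^ p.2 * (4 * 2 ^ p.1) * (4 / (2 ^ p.1 * 2 ^ p.1 * (3 ^ p.2 * 3 ^ p.2))) := by gcongr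
      _ = 16 * (1 / 2 ^ p.1 * (1 / 3 ^ p.2)) := by field_simp; norm_num

/-- Square Bernoulli's inequality for 6/5 and use 36/25 ≤ 3/2. With m = 2^n this turns N (2/3)^N
into O(1/N) = O(2^{-n}), a geometric bound. -/
lemma sq_le_three_halves_pow (m : ℕ) : (m : ℝ) ^ 2 ≤ 25 * (3 / 2) ^ m := by
  have h : (1 : ℝ) + m * (1 / 5) ≤ (1 + 1 / 5) ^ m := one_add_mul_le_pow (by norm_num) m
  have h2 : ((1 : ℝ) + m * (1 / 5)) ^ 2 ≤ ((1 + 1 / 5) ^ m) ^ 2 := by gcongr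
  rw [pow_right_comm] at h2
  have h3 : (((1 : ℝ) + 1 / 5) ^ 2) ^ m ≤ (3 / 2) ^ m := by gcongr; norm_num
  nlinarith [Nat.cast_nonneg (α := ℝ) m]

lemma summable_drift_sq : Summable fun x => drift x ^ 2 := by
  refine summable_of_levels
    (fun n : ℕ => Fin (3 ^ (2 ^ n)) × Fin (2 ^ (2 ^ n) * (3 * 2 ^ n) + 1))
    (fun n q => vtx n (2 ^ n) q.1 q.2) (fun n => 1 / 9 ^ (2 ^ n)) (fun _ => sq_nonneg _) ?_ ?_ ?_
  · rintro n ⟨j, k⟩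
    by_cases h : Valid n (2 ^ n) j k
    · have := pow_le_one₀ (n := 2) (abs_nonneg _)
        (abs_cumul_le h.one_le ((k : ℕ) / 2 ^ (2 ^ n) + 1))
      rw [drift_vtx h (by positivity), if_pos rfl, div_pow, ← sq_abs, pow_right_comm 3 _ 2]
      norm_num at this ⊢
      rw [div_eq_mul_inv]
      exact mul_le_of_le_one_left (by positivity) (by simpa using this)
    · rw [vtx_of_not_valid h, root, drift_inl, zero_pow two_ne_zero]
      positivity
  · intro x hx
    obtain ⟨n, j, k, -, h, rfl, -⟩ := exists_of_drift_ne_zero (y := x)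
      (fun h0 => hx (by simp [h0]))
    exact ⟨n, (⟨j, h.lt⟩, ⟨k, Nat.lt_succ_of_le h.le⟩), rfl⟩
  -- Here 100 = 4 · 25, from `3 * N * 2 ^ N + 1 ≤ 4 * N * 2 ^ N` and the preceding lemma.
  · refine Summable.of_nonneg_of_le (fun p => by positivity) (fun n => ?_)
      ((summable_geometric_of_lt_one (r := (1 / 2 : ℝ)) (by norm_num) (by norm_num)).mul_left 100)
    simp only [Fintype.card_prod, Fintype.card_fin]
    push_cast
    have hb := sq_le_three_halves_pow (2 ^ n)
    generalize hN : 2 ^ n = N at *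
    have hN' : (2 : ℝ) ^ n = N := by exact_mod_cast hN
    have hN0 : (1 : ℝ) ≤ N := by rw [← hN']; exact one_le_pow₀ (by norm_num)
    have h9 : (9 : ℝ) ^ N = 3 ^ N * 3 ^ N := by rw [← mul_pow]; norm_num
    rw [div_pow] at hb
    rw [h9, one_div_pow, hN', mul_one_div, mul_one_div,
      div_le_div_iff₀ (by positivity) (by positivity)]
    have h2 : (1 : ℝ) ≤ 2 ^ N := one_le_pow₀ (by norm_num)
    have h3 : (N : ℝ) ^ 2 * 2 ^ N ≤ 25 * 3 ^ N := by
      rw [← mul_div_assoc, le_div_iff₀ (by positivity)] at hb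
      exact hb
    have h4 : (2 : ℝ) ^ N * (3 * N) + 1 ≤ 4 * (2 ^ N * N) := by nlinarith
    calc (3 : ℝ) ^ N * (2 ^ N * (3 * N) + 1) * N ≤ 3 ^ N * (4 * (2 ^ N * N)) * N := by gcongr
      _ = 4 * 3 ^ N * (N ^ 2 * 2 ^ N) := by ring
      _ ≤ 4 * 3 ^ N * (25 * 3 ^ N) := by gcongr
      _ = 100 * (3 ^ N * 3 ^ N) := by ring

lemma exists_flow_of_finite_energy :
    ∃ f : PsiVert → PsiVert → ℝ, IsUnitFlowToInfinity Psi root f ∧ HasFiniteEnergy f := by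
  refine ⟨fun x y => edgeFlow below descent x y + edgeFlow right drift x y,
    ⟨fun x y => ?_, fun x y hxy => ?_, fun x => ?_⟩,
    (hasFiniteEnergy_edgeFlow _ summable_descent_sq).add
      (hasFiniteEnergy_edgeFlow _ summable_drift_sq)⟩
  · rw [edgeFlow_antisymm below, edgeFlow_antisymm right]
    ring
  · rw [edgeFlow_eq_zero (fun x => psi_adj_below) hxy,
      edgeFlow_eq_zero (fun x => psi_adj_of_drift) hxy, add_zero]
  · rw [Finset.sum_add_distrib]
    rcases exists_eq_vtx x with ⟨s, rfl⟩ | ⟨n, i, j, k, h, hi, rfl⟩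
    · rw [outflow_descent_inl, outflow_drift_inl, add_zero]
      simp [root]
    · rw [outflow_descent_vtx h hi, outflow_drift_vtx h hi, if_neg (c := vtx n i j k = root) (vtx_ne_inl h hi 0)]
      split_ifs <;> ring

end Flow
end Souvlaki

theorem mainTheorem4 :
    Souvlaki.IsTransient Souvlaki.Psi ∧
    ∃ f : Souvlaki.PsiVert → Souvlaki.PsiVert → ℝ,
      Souvlaki.IsUnitFlowToInfinity Souvlaki.Psi Souvlaki.root f ∧
      Souvlaki.HasFiniteEnergy f :=
  ⟨Souvlaki.isTransient_of_flow Souvlaki.psi_preconnected Souvlaki.exists_flow_of_finite_energy,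
    Souvlaki.exists_flow_of_finite_energy⟩
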